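/- Let $\mathbb D\subset\mathbb C$ be the open unit disc, let $n\ge 0$, and let $D\subset\mathbb C^n$ be a bounded pseudoconvex domain that is balanced, i.e. $\lambda z\in D$ for all $z\in D$, $|\lambda|\le 1$. (Pseudoconvex means that $D$ has a continuous plurisubharmonic exhaustion function.) Let $$h_D(z)=\inf\{t>0:\ z/t\in D\},\qquad z\in\mathbb C^n,$$ be the Minkowski function of $D$, and let $\widehat h_D=h_{\widehat D}$ be the Minkowski function of the convex hull $\widehat D$ of $D$. For $z,w\in D$ let $$\tilde k_D(z,w)=\inf\{\tanh^{-1}|\alpha|:\ \alpha\in\mathbb D,\ \exists\,\varphi:\mathbb D\to D\text{ holomorphic},\ \varphi(0)=z,\ \varphi(\alpha)=w\}$$ be the Lempert function of $D$ and, for each integer $m\ge 1$, let $$k_D^{(m)}(z,w)=\inf\Big\{\sum_{j=1}^m\tilde k_D(z_{j-1},z_j):\ z_0,\dots,z_m\in D,\ z_0=z,\ z_m=w\Big\}$$ be the $m$-th Lempert function; put $(k_D^{(m)})^*=\tanh k_D^{(m)}$ (infima are taken in $[0,\infty]$, and $\tanh\infty=1$). Let $a\in D$ and let $m\ge 1$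 be an integer. Assume that $h_D$ is continuous at $a$ and that $\partial D$ contains no nontrivial analytic disc through $a/h_D(a)$, i.e. every holomorphic map $\varphi:\mathbb D\to\mathbb C^n$ with $\varphi(\mathbb D)\subset\partial D$ and $a/h_D(a)\in\varphi(\mathbb D)$ is constant (for $a=0$ the condition on discs is void). Then $$(k_D^{(m)}(0,\tilde a))^*=\widehat h_D(\tilde a)\ \text{ for all }\ \tilde a\in\mathbb D_{D,a}:=\{\lambda a:\ \lambda\in\mathbb C,\ |\lambda|\,h_D(a)<1\}$$ if and only if $h_D(a)=\widehat h_D(a)$. -/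

import Mathlib

open Set Metric Filter Topology
open scoped ENNReal

noncomputable section

/-- A continuous real-valued function `u` on `D ⊆ ℂⁿ` is plurisubharmonic: it satisfies the
sub-mean value inequality on every closed affine complex disc contained in `D`. -/
def IsContPSHOn {n : ℕ} (u : EuclideanSpace ℂ (Fin n) → ℝ)
    (D : Set (EuclideanSpace ℂ (Fin n))) : Prop :=
  ContinuousOn u D ∧
    ∀ z w : EuclideanSpace ℂ (Fin n),
      (∀ ζ : ℂ, ‖ζ‖ ≤ 1 → z + ζ • w ∈ D) →
        u z ≤ Real.circleAverage (fun ζ : ℂ => u (z + ζ • w)) 0 1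

/-- `D` is pseudoconvex: it has a continuous plurisubharmonic exhaustion function. -/
def IsPseudoconvex {n : ℕ} (D : Set (EuclideanSpace ℂ (Fin n))) : Prop :=
  ∃ u : EuclideanSpace ℂ (Fin n) → ℝ,
    IsContPSHOn u D ∧ ∀ c : ℝ, IsCompact {z | z ∈ D ∧ u z ≤ c}

/-- `φ ∈ 𝒪(𝔻, S)`: the map `φ` is holomorphic on the open unit disc, with values in `S` there. -/
def IsAnalyticDiscIn {n : ℕ} (φ : ℂ → EuclideanSpace ℂ (Fin n))
    (S : Set (EuclideanSpace ℂ (Fin n))) : Prop :=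
  DifferentiableOn ℂ φ (ball 0 1) ∧ MapsTo φ (ball 0 1) S

/-- `S` contains a nontrivial (that is, nonconstant) analytic disc through `b`. -/
def HasNontrivialDiscThrough {n : ℕ} (S : Set (EuclideanSpace ℂ (Fin n)))
    (b : EuclideanSpace ℂ (Fin n)) : Prop :=
  ∃ φ : ℂ → EuclideanSpace ℂ (Fin n), IsAnalyticDiscIn φ S ∧
    b ∈ φ '' ball 0 1 ∧ ∃ ζ ∈ ball (0 : ℂ) 1, φ ζ ≠ b

/-- The Lempert function of `D`, with values in `[0, ∞]` (the infimum of the empty set is `∞`). -/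
def lempert {n : ℕ} (D : Set (EuclideanSpace ℂ (Fin n)))
    (z w : EuclideanSpace ℂ (Fin n)) : ℝ≥0∞ :=
  sInf {r | ∃ (φ : ℂ → EuclideanSpace ℂ (Fin n)) (α : ℂ), IsAnalyticDiscIn φ D ∧
    α ∈ ball (0 : ℂ) 1 ∧ φ 0 = z ∧ φ α = w ∧ r = ENNReal.ofReal (Real.artanh ‖α‖)}

/-- The `m`-th Lempert function of `D`: the infimum, over chains `z = p 0, p 1, …, p m = w`
of points of `D`, of the sum of the Lempert functions of consecutive points. -/
def lempertChain {n : ℕ} (D : Set (EuclideanSpace ℂ (Fin n))) (m : ℕ)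
    (z w : EuclideanSpace ℂ (Fin n)) : ℝ≥0∞ :=
  sInf {r | ∃ p : Fin (m + 1) → EuclideanSpace ℂ (Fin n), (∀ j, p j ∈ D) ∧
    p 0 = z ∧ p (Fin.last m) = w ∧ r = ∑ j : Fin m, lempert D (p j.castSucc) (p j.succ)}

/-- The hyperbolic tangent on `[0, ∞]`, with `tanh ∞ = 1`. -/
def tanhENN (x : ℝ≥0∞) : ℝ :=
  if x = ∞ then 1 else Real.tanh x.toReal

/-- The slice `{λ a : |λ| h_D(a) < 1}` of `D` through `a`. The Minkowski function
`h_D(z) = inf {t > 0 : z / t ∈ D}` is `gauge D`. -/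
def discSlice {n : ℕ} (D : Set (EuclideanSpace ℂ (Fin n)))
    (a : EuclideanSpace ℂ (Fin n)) : Set (EuclideanSpace ℂ (Fin n)) :=
  {z | ∃ c : ℂ, ‖c‖ * gauge D a < 1 ∧ z = c • a}

end

/-! Write h and ĥ for the Minkowski functions of `D` and its convex hull. If h(a) = ĥ(a), the linear
disc ζ ↦ ζ a / h(a) bounds the chain function at `c • a` above by artanh(|c| h(a)). A Hahn–Banach
functional, of modulus less than 1 on the hull and at least ĥ at `c • a`, bounds it below by the
same number, by Schwarz–Pick summed along chains.

Conversely, suppose ĥ(a) < h(a) and let b = a / h(a), so that ĥ(b) < 1 = h(b). Chains from 0 to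
points t b, t → 1, can then be chosen with bounded total length. Each link is an analytic disc;
recentred at its later endpoint, it has a limit disc through b in the closure of `D`. By
`IsPseudoconvex.notMem_of_tendstoLocallyUniformlyOn` the limit avoids `D`, so it lies in the
boundary and is constant. The earlier endpoint therefore also tends to b (`tendsto_of_lempert_lt`).
Going back along the chain gives 0 → b, which is absurd.

The limit disc avoids `D` because entering it would leave room to enlarge the approximating discs on
an arc of a circle. Multiplying by a suitable exponential spreads this gain to the centre, and the
Kontinuitätssatz then makes h at the centres stay below a constant less than 1, while continuity
makes it tend to 1. -/

/-! ### Maximum principle and Kontinuitätssatz -/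

open scoped ComplexConjugate in
/-- A continuous plurisubharmonic function admits no local maximum of
`u z - C ‖z - f ζ‖² + ε ‖ζ‖²` in the pair `(z, ζ)` when `f` is holomorphic and `0 < ε`. -/
theorem IsContPSHOn.false_of_eventually_penalized_le {n : ℕ} {u : EuclideanSpace ℂ (Fin n) → ℝ}
    {D : Set (EuclideanSpace ℂ (Fin n))} (hu : IsContPSHOn u D) (hD : IsOpen D)
    {f : ℂ → EuclideanSpace ℂ (Fin n)} {z₀ : EuclideanSpace ℂ (Fin n)} {ζ₀ : ℂ} {C ε : ℝ}
    (hf : ∀ᶠ ζ in 𝓝 ζ₀, DifferentiableAt ℂ f ζ) (hz₀ : z₀ ∈ D) (hC : 0 ≤ C) (hε : 0 < ε)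
    (hmax : ∀ᶠ p : EuclideanSpace ℂ (Fin n) × ℂ in 𝓝 (z₀, ζ₀),
      u p.1 - C * ‖p.1 - f p.2‖ ^ 2 + ε * ‖p.2‖ ^ 2
        ≤ u z₀ - C * ‖z₀ - f ζ₀‖ ^ 2 + ε * ‖ζ₀‖ ^ 2) : False := by
  set v := deriv f ζ₀ with hv
  set g : ℂ → EuclideanSpace ℂ (Fin n) := fun s => f (ζ₀ + s) - f ζ₀ - s • v with hg
  set d := z₀ - f ζ₀ with hd
  -- Moving `z` along the affine disc tangent to `f` leaves only the remainder `g s`. With this `κ`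
  -- its penalty C‖g s‖² is smaller than the gain ε‖s‖².
  obtain ⟨κ, hκ0, hκ⟩ : ∃ κ : ℝ, 0 < κ ∧ C * κ ^ 2 < ε := by
    refine ⟨√(ε / (C + 1)), by positivity, ?_⟩
    rw [Real.sq_sqrt (by positivity), mul_div_assoc', div_lt_iff₀ (by positivity)]
    nlinarith
  have hgo : ∀ᶠ s in 𝓝 (0 : ℂ), ‖g s‖ ≤ κ * ‖s‖ := by
    have := (hasDerivAt_iff_isLittleO_nhds_zero.1 hf.self_of_nhds.hasDerivAt).def hκ0
    simpa [hg, hv] using this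
  have ht : Tendsto (fun s : ℂ => (z₀ + s • v, ζ₀ + s)) (𝓝 0) (𝓝 (z₀, ζ₀)) := by
    have : Continuous (fun s : ℂ => (z₀ + s • v, ζ₀ + s)) := by fun_prop
    simpa using this.tendsto 0
  have hD' : ∀ᶠ s in 𝓝 (0 : ℂ), z₀ + s • v ∈ D :=
    (ht.fst_nhds) (hD.mem_nhds hz₀)
  have hf' : ∀ᶠ s in 𝓝 (0 : ℂ), DifferentiableAt ℂ f (ζ₀ + s) := ht.snd_nhds hf
  obtain ⟨ρ, hρ, hall⟩ := Metric.eventually_nhds_iff_ball.1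
    (hgo.and (hD'.and (hf'.and (ht.eventually hmax))))
  set r := ρ / 2 with hr
  have hr0 : 0 < r := by positivity
  have hmem : ∀ ζ : ℂ, ‖ζ‖ ≤ 1 → (r : ℂ) * ζ ∈ ball (0 : ℂ) ρ := by
    intro ζ hζ
    rw [mem_ball_zero_iff, norm_mul, Complex.norm_real, Real.norm_of_nonneg hr0.le]
    nlinarith
  have hsm : ∀ ζ : ℂ, z₀ + ζ • ((r : ℂ) • v) = z₀ + ((r : ℂ) * ζ) • v := by
    intro ζ; rw [smul_smul, mul_comm]
  have hdisc : ∀ ζ : ℂ, ‖ζ‖ ≤ 1 → z₀ + ζ • ((r : ℂ) • v) ∈ D := by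
    intro ζ hζ
    rw [hsm]
    exact (hall _ (hmem ζ hζ)).2.1
  -- The cross terms of the two expanded squares form the real part of a holomorphic function
  -- vanishing at 0, so their circle average is 0.
  set H : ℂ → ℂ := fun ζ => -2 * C * inner ℂ d (g (r * ζ)) - 2 * ε * (conj ζ₀ * (r * ζ)) with hH
  have hHd : DiffContOnCl ℂ H (ball 0 |1|) := by
    refine DifferentiableOn.diffContOnCl fun ζ hζ => DifferentiableAt.differentiableWithinAt ?_
    rw [abs_one, closure_ball _ one_ne_zero, mem_closedBall_zero_iff] at hζ
    have h1 : DifferentiableAt ℂ f (ζ₀ + r * ζ) := (hall _ (hmem ζ hζ)).2.2.1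
    have h2 : DifferentiableAt ℂ (fun ζ : ℂ => f (ζ₀ + r * ζ)) ζ :=
      DifferentiableAt.comp (g := f) (f := fun ζ : ℂ => ζ₀ + r * ζ) ζ h1 (by fun_prop)
    have h3 : DifferentiableAt ℂ (fun ζ : ℂ => g (r * ζ)) ζ := by
      simp only [hg]
      fun_prop
    have h4 : DifferentiableAt ℂ (fun ζ : ℂ => inner ℂ d (g (r * ζ))) ζ :=
      (innerSL ℂ d).differentiableAt.comp ζ h3
    simp only [hH]
    fun_prop
  have hH0 : H 0 = 0 := by simp [hH, hg]
  have hHc : ContinuousOn H (sphere 0 |1|) := by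
    refine hHd.continuousOn.mono ?_
    rw [abs_one, closure_ball _ one_ne_zero]
    exact sphere_subset_closedBall
  have hHi : CircleIntegrable H 0 1 := hHc.circleIntegrable'
  have havg : Real.circleAverage (fun ζ => (H ζ).re) 0 1 = 0 := by
    have := Complex.reCLM.circleAverage_comp_comm hHi
    rw [hHd.circleAverage, hH0] at this
    exact this.trans (map_zero _)
  have hrei : CircleIntegrable (fun ζ => (H ζ).re) 0 1 :=
    (Complex.continuous_re.comp_continuousOn hHc).circleIntegrable'
  have hui : CircleIntegrable (fun ζ : ℂ => u (z₀ + ζ • ((r : ℂ) • v))) 0 1 := by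
    refine ContinuousOn.circleIntegrable' (hu.1.comp (by fun_prop) fun ζ hζ => hdisc ζ ?_)
    simpa using (mem_sphere_zero_iff_norm.1 hζ).le
  have hpt : ∀ ζ ∈ sphere (0 : ℂ) |1|, u (z₀ + ζ • ((r : ℂ) • v))
      ≤ (u z₀ + (C * κ ^ 2 - ε) * r ^ 2) + (H ζ).re := by
    intro ζ hζ
    have hζ1 : ‖ζ‖ = 1 := by simpa using hζ
    obtain ⟨h1, -, -, h2⟩ := hall _ (hmem ζ hζ1.le)
    rw [hsm]
    have hs : ‖(r : ℂ) * ζ‖ = r := by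
      rw [norm_mul, Complex.norm_real, Real.norm_of_nonneg hr0.le, hζ1, mul_one]
    simp only [hH]
    set s := (r : ℂ) * ζ
    have e1 : z₀ + s • v - f (ζ₀ + s) = d - g s := by simp only [hd, hg]; abel
    have e2 : ‖d - g s‖ ^ 2 = ‖d‖ ^ 2 - 2 * (inner ℂ d (g s)).re + ‖g s‖ ^ 2 :=
      norm_sub_sq (𝕜 := ℂ) d (g s)
    have e3 : ‖ζ₀ + s‖ ^ 2 = ‖ζ₀‖ ^ 2 + 2 * (conj ζ₀ * s).re + ‖s‖ ^ 2 := by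
      have := norm_add_sq (𝕜 := ℂ) ζ₀ s
      simpa [mul_comm] using this
    simp only [e1, e2, e3, hs] at h2
    rw [hs] at h1
    have h3 : ‖g s‖ ^ 2 ≤ κ ^ 2 * r ^ 2 := by
      rw [← mul_pow]; exact pow_le_pow_left₀ (norm_nonneg _) h1 2
    have h4 := mul_le_mul_of_nonneg_left h3 hC
    have e4 : (-2 * (C : ℂ) * inner ℂ d (g s) - 2 * ε * (conj ζ₀ * s)).re
        = -2 * C * (inner ℂ d (g s)).re - 2 * ε * (conj ζ₀ * s).re := by
      have a1 : (-2 * (C : ℂ)) = ((-2 * C : ℝ) : ℂ) := by push_cast; ring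
      have a2 : (2 * (ε : ℂ)) = ((2 * ε : ℝ) : ℂ) := by push_cast; ring
      rw [Complex.sub_re, a1, a2, Complex.re_ofReal_mul, Complex.re_ofReal_mul]
    rw [e4]
    nlinarith
  have hci : CircleIntegrable (fun _ : ℂ => u z₀ + (C * κ ^ 2 - ε) * r ^ 2) 0 1 :=
    continuousOn_const.circleIntegrable'
  have key := (hu.2 z₀ _ hdisc).trans (Real.circleAverage_mono hui (hci.add hrei) hpt)
  have : Real.circleAverage ((fun _ : ℂ => u z₀ + (C * κ ^ 2 - ε) * r ^ 2) + fun ζ => (H ζ).re) 0 1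
      = u z₀ + (C * κ ^ 2 - ε) * r ^ 2 := by
    rw [Real.circleAverage_add hci hrei, havg, Real.circleAverage_const, add_zero]
  have hneg : (C * κ ^ 2 - ε) * r ^ 2 < 0 := mul_neg_of_neg_of_pos (by linarith) (by positivity)
  change u z₀ ≤ Real.circleAverage ((fun _ : ℂ => u z₀ + (C * κ ^ 2 - ε) * r ^ 2) + fun ζ => (H ζ).re) 0 1 at key
  linarith

/-- Maximum principle for a continuous plurisubharmonic function along an analytic disc. -/
theorem IsContPSHOn.le_of_forall_sphere_le {n : ℕ} {u : EuclideanSpace ℂ (Fin n) → ℝ}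
    {D : Set (EuclideanSpace ℂ (Fin n))} (hu : IsContPSHOn u D) (hD : IsOpen D)
    {f : ℂ → EuclideanSpace ℂ (Fin n)} (hf : DiffContOnCl ℂ f (ball 0 1))
    (hfD : MapsTo f (closedBall 0 1) D) {c : ℝ} (hc : ∀ ζ ∈ sphere (0 : ℂ) 1, u (f ζ) ≤ c)
    {ζ : ℂ} (hζ : ζ ∈ closedBall (0 : ℂ) 1) : u (f ζ) ≤ c := by
  by_contra! hlt
  set μ := u (f ζ) - c with hμ
  have hμ0 : 0 < μ := by linarith
  have hfc : ContinuousOn f (closedBall 0 1) := by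
    simpa [closure_ball (0 : ℂ) one_ne_zero] using hf.continuousOn
  have hcomp : IsCompact (f '' closedBall 0 1) := (isCompact_closedBall 0 1).image_of_continuousOn hfc
  obtain ⟨δ, hδ, hδD⟩ := hcomp.exists_cthickening_subset_open hD (image_subset_iff.2 hfD)
  set K := cthickening δ (f '' closedBall 0 1) with hK
  have hKc : IsCompact K := hcomp.cthickening
  have huK : ContinuousOn u K := hu.1.mono hδD
  have hfK : ∀ ξ ∈ closedBall (0 : ℂ) 1, f ξ ∈ K := fun ξ hξ =>
    self_subset_cthickening _ (mem_image_of_mem f hξ)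
  obtain ⟨M, hM⟩ := hKc.exists_bound_of_continuousOn huK
  obtain ⟨τ, hτ, hτu⟩ := Metric.uniformContinuousOn_iff.1
    (hKc.uniformContinuousOn_of_continuous huK) (μ / 4) (by positivity)
  have hM0 : 0 ≤ M := (norm_nonneg _).trans (hM _ (hfK ζ hζ))
  obtain ⟨σ, hσ0, hστ, hσδ⟩ : ∃ σ : ℝ, 0 < σ ∧ σ < τ ∧ σ < δ :=
    ⟨min τ δ / 2, by positivity, by linarith [min_le_left τ δ, half_lt_self (lt_min hτ hδ)],
      by linarith [min_le_right τ δ, half_lt_self (lt_min hτ hδ)]⟩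
  -- Doubling of variables: the submean inequality sees only affine discs, so `z` is freed from `f
  -- ζ` at a quadratic cost. This `C` forces a maximiser within `σ` of the disc, hence inside `K`
  -- and with `u` changed by less than μ/4. The weight μ/4 on ‖ζ‖² is too small to let it reach the
  -- unit circle.
  set C := (2 * M + μ + 1) / σ ^ 2 with hC
  have hC0 : 0 ≤ C := by positivity
  set F : EuclideanSpace ℂ (Fin n) × ℂ → ℝ :=
    fun p => u p.1 - C * ‖p.1 - f p.2‖ ^ 2 + μ / 4 * ‖p.2‖ ^ 2 with hF
  have hFc : ContinuousOn F (K ×ˢ closedBall 0 1) := by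
    have h1 : ContinuousOn (fun p : EuclideanSpace ℂ (Fin n) × ℂ => u p.1) (K ×ˢ closedBall 0 1) :=
      huK.comp continuousOn_fst fun p hp => hp.1
    have h2 : ContinuousOn (fun p : EuclideanSpace ℂ (Fin n) × ℂ => f p.2) (K ×ˢ closedBall 0 1) :=
      hfc.comp continuousOn_snd fun p hp => hp.2
    exact (h1.sub (continuousOn_const.mul ((continuousOn_fst.sub h2).norm.pow 2))).add
      (by fun_prop)
  obtain ⟨⟨z₀, ζ₀⟩, ⟨hz₀, hζ₀⟩, hmax⟩ := (hKc.prod (isCompact_closedBall (0 : ℂ) 1)).exists_isMaxOn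
    ⟨(f ζ, ζ), hfK ζ hζ, hζ⟩ hFc
  simp only at hz₀ hζ₀
  have hlow : c + μ ≤ F (z₀, ζ₀) := by
    refine le_trans ?_ (hmax (show (f ζ, ζ) ∈ _ from ⟨hfK ζ hζ, hζ⟩))
    have : 0 ≤ μ / 4 * ‖ζ‖ ^ 2 := by positivity
    simp only [hF, sub_self, norm_zero]
    simp only [hμ] at this ⊢
    linarith
  have hζ1 : ‖ζ₀‖ ^ 2 ≤ 1 := pow_le_one₀ (norm_nonneg _) (mem_closedBall_zero_iff.1 hζ₀)
  have hclose : ‖z₀ - f ζ₀‖ < σ := by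
    by_contra! hge
    have h1 : 2 * M + μ + 1 ≤ C * ‖z₀ - f ζ₀‖ ^ 2 := by
      calc 2 * M + μ + 1 = C * σ ^ 2 := by rw [hC]; field_simp
        _ ≤ _ := by gcongr
    have h2 := abs_le.1 (hM z₀ hz₀)
    have h3 := abs_le.1 (hM (f ζ) (hfK ζ hζ))
    simp only [hF] at hlow
    nlinarith
  have hu4 : u z₀ < u (f ζ₀) + μ / 4 := by
    have := hτu z₀ hz₀ (f ζ₀) (hfK _ hζ₀) (by rw [dist_eq_norm]; linarith)
    rw [Real.dist_eq] at this
    linarith [(abs_lt.1 this).2]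
  have hin : ‖ζ₀‖ < 1 := by
    refine lt_of_le_of_ne (mem_closedBall_zero_iff.1 hζ₀) fun h1 => ?_
    have h2 := hc ζ₀ (mem_sphere_zero_iff_norm.2 h1)
    have h3 : 0 ≤ C * ‖z₀ - f ζ₀‖ ^ 2 := by positivity
    simp only [hF] at hlow
    nlinarith
  refine hu.false_of_eventually_penalized_le hD (f := f) (z₀ := z₀) (ζ₀ := ζ₀) (C := C)
    (ε := μ / 4) ?_ (hδD hz₀) hC0 (by positivity) ?_
  · filter_upwards [isOpen_ball.mem_nhds (mem_ball_zero_iff.2 hin)] with ξ hξ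
    exact hf.differentiableOn.differentiableAt (isOpen_ball.mem_nhds hξ)
  · have hKn : K ∈ 𝓝 z₀ := by
      refine mem_of_superset (isOpen_ball.mem_nhds
        (show z₀ ∈ ball (f ζ₀) δ by rw [mem_ball, dist_eq_norm]; linarith)) fun y hy => ?_
      exact mem_cthickening_of_dist_le y (f ζ₀) δ _ (mem_image_of_mem f hζ₀) (mem_ball.1 hy).le
    filter_upwards [prod_mem_nhds hKn (mem_of_superset
      (isOpen_ball.mem_nhds (mem_ball_zero_iff.2 hin)) ball_subset_closedBall)] with p hp
    exact hmax hp

/-- Kontinuitätssatz for balanced pseudoconvex sets: an analytic disc whose boundary lies in such a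
set lies in it entirely. -/
theorem IsPseudoconvex.mapsTo_closedBall_of_mapsTo_sphere {n : ℕ}
    {D : Set (EuclideanSpace ℂ (Fin n))} (hp : IsPseudoconvex D) (hD : IsOpen D)
    (hbal : Balanced ℂ D) {f : ℂ → EuclideanSpace ℂ (Fin n)}
    (hf : DiffContOnCl ℂ f (ball 0 1)) (hfD : MapsTo f (sphere 0 1) D) :
    MapsTo f (closedBall 0 1) D := by
  obtain ⟨u, hu, hcpt⟩ := hp
  have hfc : ContinuousOn f (closedBall 0 1) := by
    simpa [closure_ball (0 : ℂ) one_ne_zero] using hf.continuousOn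
  have hsm : ∀ t ∈ Icc (0 : ℝ) 1, ∀ x ∈ D, t • x ∈ D := by
    intro t ht x hx
    have := hbal.smul_mem (a := (t : ℂ)) (by
      rw [Complex.norm_real, Real.norm_of_nonneg ht.1]; exact ht.2) hx
    simpa using this
  obtain ⟨c, hc⟩ : ∃ c, ∀ t ∈ Icc (0 : ℝ) 1, ∀ ζ ∈ sphere (0 : ℂ) 1, u (t • f ζ) ≤ c := by
    have hk : IsCompact (Icc (0 : ℝ) 1 ×ˢ sphere (0 : ℂ) 1) := isCompact_Icc.prod (isCompact_sphere 0 1)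
    have hcts : ContinuousOn (fun p : ℝ × ℂ => u (p.1 • f p.2)) (Icc (0 : ℝ) 1 ×ˢ sphere (0 : ℂ) 1) := by
      refine hu.1.comp (continuousOn_fst.smul ((hfc.mono sphere_subset_closedBall).comp
        continuousOn_snd fun p hp => hp.2)) fun p hp => hsm _ hp.1 _ (hfD hp.2)
    obtain ⟨c, hc⟩ := hk.bddAbove_image hcts
    exact ⟨c, fun t ht ζ hζ => hc ⟨(t, ζ), ⟨ht, hζ⟩, rfl⟩⟩
  -- Continuity method in the dilation parameter: compact sublevels make `T` closed, and the maximum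
  -- principle returns nearby discs in `D` to the sublevel `c`.
  set T : Set ℝ := {t | MapsTo (fun ζ => t • f ζ) (closedBall 0 1) {z | z ∈ D ∧ u z ≤ c}} with hT
  have h0D : (0 : EuclideanSpace ℂ (Fin n)) ∈ D := by
    simpa using hbal.smul_mem (a := (0 : ℂ)) (by simp) (hfD (show (1 : ℂ) ∈ sphere 0 1 by simp))
  have step : ∀ t ∈ Icc (0 : ℝ) 1, MapsTo (fun ζ => t • f ζ) (closedBall 0 1) D → t ∈ T := by
    intro t ht hmt ζ hζ
    refine ⟨hmt hζ, ?_⟩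
    have hf' : DiffContOnCl ℂ (fun ζ => t • f ζ) (ball 0 1) := by
      simpa [Pi.smul_def] using hf.const_smul (t : ℂ)
    exact hu.le_of_forall_sphere_le hD hf' hmt (hc t ht) hζ
  have hclosed : IsClosed T := by
    have : T = ⋂ ζ ∈ closedBall (0 : ℂ) 1, (fun t : ℝ => t • f ζ) ⁻¹' {z | z ∈ D ∧ u z ≤ c} := by
      ext t; simp [hT, MapsTo]
    rw [this]
    exact isClosed_biInter fun ζ _ => (hcpt c).isClosed.preimage (by fun_prop)
  have hsub : Icc (0 : ℝ) 1 ⊆ T := by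
    refine IsClosed.Icc_subset_of_forall_exists_gt (hclosed.inter isClosed_Icc)
      (step 0 (by simp) fun ζ _ => by simpa using h0D) ?_
    rintro t ⟨htT, ht⟩ y hy
    have hev : ∀ᶠ s in 𝓝 t, ∀ ζ ∈ closedBall (0 : ℂ) 1, s • f ζ ∈ D := by
      have hK : IsCompact ((fun ζ => f ζ) '' closedBall 0 1) :=
        (isCompact_closedBall 0 1).image_of_continuousOn hfc
      have hopen : IsOpen {p : ℝ × EuclideanSpace ℂ (Fin n) | p.1 • p.2 ∈ D} :=
        hD.preimage (by fun_prop)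
      have := hK.eventually_forall_of_forall_eventually (x₀ := t) (P := fun s x => s • x ∈ D)
        (by
          rintro _ ⟨ζ, hζ, rfl⟩
          exact hopen.mem_nhds (htT hζ).1)
      filter_upwards [this] with s hs ζ hζ using hs _ (mem_image_of_mem _ hζ)
    have h1 : ∀ᶠ s in 𝓝[>] t, s ∈ Ioc t (min y 1) :=
      Ioc_mem_nhdsGT (lt_min hy ht.2)
    obtain ⟨s, hs, hs2⟩ := ((hev.filter_mono nhdsWithin_le_nhds).and h1).exists
    exact ⟨s, step s ⟨ht.1.trans hs2.1.le, hs2.2.trans (min_le_right _ _)⟩ hs,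
      hs2.1, hs2.2.trans (min_le_left _ _)⟩
  intro ζ hζ
  simpa using (hsub (right_mem_Icc.2 zero_le_one) hζ).1

/-! ### Limits of discs avoid the domain -/

/-- There is a holomorphic function on the closed unit disc whose real part is positive at the
centre and nonpositive on the unit circle away from a given point of the circle. -/
theorem exists_re_pos_and_re_nonpos_on_sphere {ω : ℂ} (hω : ‖ω‖ = 1) {ρ : ℝ} (hρ : 0 < ρ) :
    ∃ q : ℂ → ℂ, DifferentiableOn ℂ q (closedBall 0 1) ∧ 0 < (q 0).re ∧
      ∀ ζ ∈ sphere (0 : ℂ) 1, ρ ≤ ‖ζ - ω‖ → (q ζ).re ≤ 0 := by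
  have hω0 : ω ≠ 0 := norm_ne_zero_iff.1 (by rw [hω]; exact one_ne_zero)
  obtain ⟨s, hs0, hs1, hsa, hsb⟩ : ∃ s : ℝ, 0 < s ∧ s < 1 ∧ 1 - s ≤ ρ / 2 ∧ 1 - s ≤ ρ ^ 2 / 16 := by
    have hm : 0 < min (1 / 2) (min (ρ / 2) (ρ ^ 2 / 16)) := by positivity
    refine ⟨1 - min (1 / 2) (min (ρ / 2) (ρ ^ 2 / 16)), ?_, by linarith, ?_, ?_⟩
    · linarith [min_le_left (1 / 2 : ℝ) (min (ρ / 2) (ρ ^ 2 / 16))]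
    · linarith [(min_le_right (1 / 2 : ℝ) _).trans (min_le_left (ρ / 2) (ρ ^ 2 / 16))]
    · linarith [(min_le_right (1 / 2 : ℝ) _).trans (min_le_right (ρ / 2) (ρ ^ 2 / 16))]
  have hsn : ∀ ζ : ℂ, ‖(s : ℂ) * ζ‖ = s * ‖ζ‖ := fun ζ => by
    rw [norm_mul, Complex.norm_real, Real.norm_of_nonneg hs0.le]
  have hne : ∀ ζ ∈ closedBall (0 : ℂ) 1, ω - s * ζ ≠ 0 := by
    intro ζ hζ h
    have h1 : ‖ω‖ = s * ‖ζ‖ := by rw [← hsn, sub_eq_zero.1 h]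
    have h2 := mem_closedBall_zero_iff.1 hζ
    nlinarith
  -- A Poisson kernel with its pole pushed out to ω/s. It is 1 at the centre and, by the choice of
  -- `s`, at most 1/2 on the circle off the `ρ`-disc about `ω`.
  refine ⟨fun ζ => (ω + s * ζ) / (ω - s * ζ) - 1 / 2, ?_, ?_, ?_⟩
  · intro ζ hζ
    have := hne ζ hζ
    fun_prop (disch := assumption)
  · norm_num [hω0]
  · intro ζ hζ hζω
    have hζ1 : ‖ζ‖ = 1 := mem_sphere_zero_iff_norm.1 hζ
    have hre : ((ω + s * ζ) / (ω - s * ζ)).re = (1 - s ^ 2) / ‖ω - s * ζ‖ ^ 2 := by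
      have e1 : 1 - s ^ 2 = ‖ω‖ ^ 2 - ‖(s : ℂ) * ζ‖ ^ 2 := by rw [hsn, hω, hζ1]; ring
      rw [e1, Complex.div_re, ← add_div, ← Complex.normSq_eq_norm_sq, ← Complex.normSq_eq_norm_sq,
        ← Complex.normSq_eq_norm_sq]
      congr 1
      simp only [Complex.normSq_apply, Complex.add_re, Complex.sub_re, Complex.add_im,
        Complex.sub_im]
      ring
    have hge : ρ / 2 ≤ ‖ω - s * ζ‖ := by
      have h1 : ‖ζ - ω‖ ≤ ‖ζ - s * ζ‖ + ‖s * ζ - ω‖ := norm_sub_le_norm_sub_add_norm_sub _ _ _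
      have h2 : ‖ζ - s * ζ‖ = 1 - s := by
        rw [show ζ - s * ζ = ((1 - s : ℝ) : ℂ) * ζ by push_cast; ring, norm_mul, hζ1,
          Complex.norm_real, Real.norm_of_nonneg (by linarith), mul_one]
      rw [norm_sub_rev (s * ζ) ω] at h1
      linarith
    have h3 : ((ω + s * ζ) / (ω - s * ζ)).re ≤ 1 / 2 := by
      have hpos : 0 < ‖ω - s * ζ‖ := by linarith
      rw [hre, div_le_iff₀ (by positivity)]
      nlinarith
    have h4 : ((1 : ℂ) / 2).re = 1 / 2 := by norm_num
    rw [Complex.sub_re, h4]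
    linarith

/-- Let holomorphic discs in a balanced pseudoconvex set converge locally uniformly, the centres
converging to a point where the Minkowski function is continuous and equal to `1`. Then the limit
disc avoids the set. -/
theorem IsPseudoconvex.notMem_of_tendstoLocallyUniformlyOn {n : ℕ}
    {D : Set (EuclideanSpace ℂ (Fin n))} (hp : IsPseudoconvex D) (hD : IsOpen D)
    (hbal : Balanced ℂ D) {ι : Type*} {l : Filter ι} [l.NeBot]
    {ψ : ι → ℂ → EuclideanSpace ℂ (Fin n)} {φ : ℂ → EuclideanSpace ℂ (Fin n)}
    (hψ : ∀ i, IsAnalyticDiscIn (ψ i) D) (hlim : TendstoLocallyUniformlyOn ψ φ l (ball 0 1))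
    (hcont : ContinuousAt (gauge D) (φ 0)) (hone : gauge D (φ 0) = 1)
    {ζ₀ : ℂ} (hζ₀ : ζ₀ ∈ ball (0 : ℂ) 1) : φ ζ₀ ∉ D := by
  intro hmem
  have hζ0 : ζ₀ ≠ 0 := by
    rintro rfl
    exact (gauge_lt_one_of_mem_of_isOpen hD hmem).ne hone
  set r := ‖ζ₀‖ with hr
  have hr0 : 0 < r := norm_pos_iff.2 hζ0
  have hr1 : r < 1 := mem_ball_zero_iff.1 hζ₀
  have hrC : (r : ℂ) ≠ 0 := by exact_mod_cast hr0.ne'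
  set ω := ζ₀ / r with hω
  have hω1 : ‖ω‖ = 1 := by
    rw [hω, norm_div, Complex.norm_real, Real.norm_of_nonneg hr0.le, div_self hr0.ne']
  have hrω : (r : ℂ) * ω = ζ₀ := by rw [hω]; field_simp
  have hrn : ∀ ζ : ℂ, ‖(r : ℂ) * ζ‖ = r * ‖ζ‖ := fun ζ => by
    rw [norm_mul, Complex.norm_real, Real.norm_of_nonneg hr0.le]
  have hmaps : MapsTo (fun ζ : ℂ => (r : ℂ) * ζ) (closedBall 0 1) (ball 0 1) := by
    intro ζ hζ
    have := mem_closedBall_zero_iff.1 hζ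
    rw [mem_ball_zero_iff, hrn]
    nlinarith
  have hφc : ContinuousOn φ (ball 0 1) :=
    hlim.continuousOn (Frequently.of_forall fun i => (hψ i).1.continuousOn)
  obtain ⟨τ, η, hτ, hη, hτη⟩ : ∃ τ η : ℝ, 0 < τ ∧ 1 < η ∧ ∀ x, dist x (φ ζ₀) < τ → η • x ∈ D := by
    have h1 : Tendsto (fun p : ℝ × EuclideanSpace ℂ (Fin n) => p.1 • p.2) (𝓝 (1, φ ζ₀))
        (𝓝 (φ ζ₀)) := by
      have : Continuous (fun p : ℝ × EuclideanSpace ℂ (Fin n) => p.1 • p.2) := by fun_prop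
      simpa using this.tendsto (1, φ ζ₀)
    have h2 := h1 (hD.mem_nhds hmem)
    rw [nhds_prod_eq] at h2
    obtain ⟨pa, hpa, pb, hpb, hab⟩ := Filter.eventually_prod_iff.1 (mem_map.1 h2)
    obtain ⟨τ, hτ, hball⟩ := Metric.eventually_nhds_iff.1 hpb
    obtain ⟨η, hη1, hη2⟩ := ((hpa.filter_mono nhdsWithin_le_nhds).and
      (self_mem_nhdsWithin (a := (1 : ℝ)) (s := Ioi 1))).exists
    exact ⟨τ, η, hτ, hη2, fun x hx => hab hη1 (hball hx)⟩
  obtain ⟨ρ, hρ, hρφ⟩ : ∃ ρ > 0, ∀ ζ ∈ closedBall (0 : ℂ) 1, ‖ζ - ω‖ < ρ →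
      dist (φ (r * ζ)) (φ ζ₀) < τ / 2 := by
    have h1 : ContinuousOn (fun ζ : ℂ => φ (r * ζ)) (closedBall 0 1) :=
      hφc.comp (by fun_prop) hmaps
    obtain ⟨ρ, hρ, h⟩ := Metric.continuousOn_iff.1 h1 ω
      (mem_closedBall_zero_iff.2 hω1.le) (τ / 2) (by positivity)
    refine ⟨ρ, hρ, fun ζ hζ hζω => ?_⟩
    have := h ζ hζ (by rwa [dist_eq_norm])
    rwa [hrω] at this
  obtain ⟨q, hq, hq0, hqω⟩ := exists_re_pos_and_re_nonpos_on_sphere hω1 hρ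
  obtain ⟨B, hB⟩ := (isCompact_closedBall (0 : ℂ) 1).exists_bound_of_continuousOn hq.continuousOn
  have hB0 : 0 ≤ B := (norm_nonneg _).trans (hB 0 (by simp))
  obtain ⟨κ, hκ0, hκ⟩ : ∃ κ : ℝ, 0 < κ ∧ Real.exp (κ * B) ≤ η := by
    have hlog : 0 < Real.log η := Real.log_pos hη
    refine ⟨Real.log η / (B + 1), by positivity, ?_⟩
    rw [← Real.le_log_iff_exp_le (by linarith), div_mul_eq_mul_div, div_le_iff₀ (by positivity)]
    nlinarith
  have hunif : ∀ᶠ i in l, ∀ ζ ∈ closedBall (0 : ℂ) 1, dist (φ (r * ζ)) (ψ i (r * ζ)) < τ / 2 := by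
    have hK : IsCompact ((fun ζ : ℂ => (r : ℂ) * ζ) '' closedBall 0 1) :=
      (isCompact_closedBall _ _).image (by fun_prop)
    have h1 := (tendstoLocallyUniformlyOn_iff_forall_isCompact isOpen_ball).1 hlim _
      hmaps.image_subset hK
    filter_upwards [Metric.tendstoUniformlyOn_iff.1 h1 (τ / 2) (by positivity)] with i hi ζ hζ
    exact hi _ (mem_image_of_mem _ hζ)
  have hnexp : ∀ ζ, ‖Complex.exp (κ * q ζ)‖ = Real.exp (κ * (q ζ).re) := fun ζ => by
    rw [Complex.norm_exp, Complex.re_ofReal_mul]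
  -- The factor exp(κ q) has modulus at most `η` near `ω`, where there is room for it, and at most 1
  -- on the rest of the circle. The Kontinuitätssatz carries the multiplied disc into `D`.
  have hev : ∀ᶠ i in l, gauge D (ψ i 0) ≤ Real.exp (-(κ * (q 0).re)) := by
    filter_upwards [hunif] with i hi
    have hdiff : DiffContOnCl ℂ (fun ζ => Complex.exp (κ * q ζ) • ψ i (r * ζ)) (ball 0 1) := by
      refine DifferentiableOn.diffContOnCl ?_
      rw [closure_ball _ one_ne_zero]
      have h1 : DifferentiableOn ℂ (fun ζ : ℂ => ψ i (r * ζ)) (closedBall 0 1) :=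
        (hψ i).1.comp (by fun_prop) hmaps
      exact (hq.const_mul _).cexp.smul h1
    have hsph : MapsTo (fun ζ => Complex.exp (κ * q ζ) • ψ i (r * ζ)) (sphere 0 1) D := by
      intro ζ hζ
      have hζ' := sphere_subset_closedBall hζ
      by_cases hc : ‖ζ - ω‖ < ρ
      · have h1 : dist (ψ i (r * ζ)) (φ ζ₀) < τ := by
          have h2 := hρφ ζ hζ' hc
          have h3 := hi ζ hζ'
          rw [dist_comm] at h3
          linarith [dist_triangle (ψ i (r * ζ)) (φ (r * ζ)) (φ ζ₀)]
        have h2 := hτη _ h1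
        have hηC : (η : ℂ) ≠ 0 := by exact_mod_cast (by linarith : η ≠ 0)
        have h3 := hbal.smul_mem (a := Complex.exp (κ * q ζ) / η) (by
          rw [norm_div, hnexp, Complex.norm_real, Real.norm_of_nonneg (by linarith),
            div_le_one (by linarith)]
          refine le_trans (Real.exp_le_exp.2 ?_) hκ
          gcongr
          exact (Complex.re_le_norm _).trans (hB ζ hζ')) h2
        rwa [← Complex.coe_smul, smul_smul, div_mul_cancel₀ _ hηC] at h3
      · refine hbal.smul_mem ?_ ((hψ i).2 (hmaps hζ'))
        rw [hnexp, Real.exp_le_one_iff]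
        exact mul_nonpos_of_nonneg_of_nonpos hκ0.le (hqω ζ hζ (not_lt.1 hc))
    have h0 := hp.mapsTo_closedBall_of_mapsTo_sphere hD hbal hdiff hsph
      (mem_closedBall_self zero_le_one)
    have h1 : gauge D (Complex.exp (κ * q 0) • ψ i 0) ≤ 1 := by
      simpa using gauge_le_one_of_mem h0
    rw [gauge_smul hbal, hnexp] at h1
    rw [Real.exp_neg, ← one_div, le_div_iff₀ (Real.exp_pos _), mul_comm]
    exact h1
  have htend : Tendsto (fun i => gauge D (ψ i 0)) l (𝓝 1) := by
    rw [← hone]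
    exact hcont.tendsto.comp (hlim.tendsto_at (mem_ball_self zero_lt_one))
  have hle := le_of_tendsto htend hev
  have : Real.exp (-(κ * (q 0).re)) < 1 := by
    rw [Real.exp_lt_one_iff]
    linarith [mul_pos hκ0 hq0]
  linarith

/-! ### Montel's theorem along ultrafilters -/

/-- A version of Montel's theorem: a uniformly bounded family of holomorphic maps on the unit disc
converges locally uniformly along every ultrafilter. -/
theorem exists_tendstoLocallyUniformlyOn_of_bounded {E : Type*} [NormedAddCommGroup E]
    [NormedSpace ℂ E] [ProperSpace E] {ι : Type*} (U : Ultrafilter ι) {ψ : ι → ℂ → E} {R : ℝ}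
    (hψ : ∀ i, DifferentiableOn ℂ (ψ i) (ball 0 1)) (hR : ∀ i, ∀ ζ ∈ ball (0 : ℂ) 1, ‖ψ i ζ‖ ≤ R) :
    ∃ φ : ℂ → E, TendstoLocallyUniformlyOn ψ φ (U : Filter ι) (ball 0 1) := by
  have hpt : ∀ ζ : ℂ, ∃ y : E, ζ ∈ ball (0 : ℂ) 1 → Tendsto (fun i => ψ i ζ) U (𝓝 y) := by
    intro ζ
    by_cases hζ : ζ ∈ ball (0 : ℂ) 1
    · obtain ⟨y, -, hy⟩ := (isCompact_closedBall (0 : E) R).ultrafilter_le_nhds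
        (U.map fun i => ψ i ζ) (by
          rw [le_principal_iff, Ultrafilter.mem_coe, Ultrafilter.mem_map]
          exact univ_mem' fun i => mem_closedBall_zero_iff.2 (hR i ζ hζ))
      exact ⟨y, fun _ => hy⟩
    · exact ⟨0, fun h => absurd h hζ⟩
  choose φ hφ using hpt
  refine ⟨φ, Metric.tendstoLocallyUniformlyOn_iff.2 fun ε hε ζ₀ hζ₀ => ?_⟩
  set d := 1 - ‖ζ₀‖ with hd
  have hd0 : 0 < d := by rw [hd, sub_pos]; exact mem_ball_zero_iff.1 hζ₀
  have hR0 : 0 ≤ R := by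
    obtain ⟨i, -⟩ := U.nonempty_of_mem univ_mem
    exact (norm_nonneg _).trans (hR i ζ₀ hζ₀)
  have hsub : ball ζ₀ d ⊆ ball 0 1 := ball_subset_ball' (by rw [dist_zero_right]; linarith)
  -- The Schwarz lemma gives one Lipschitz constant for the whole family, which upgrades pointwise
  -- to locally uniform convergence.
  have hlip : ∀ i, ∀ ζ ∈ ball ζ₀ d, dist (ψ i ζ) (ψ i ζ₀) ≤ 2 * R / d * dist ζ ζ₀ := by
    intro i ζ hζ
    refine Complex.dist_le_div_mul_dist_of_mapsTo_ball ((hψ i).mono hsub) (fun ξ hξ => ?_) hζ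
    rw [mem_closedBall, dist_eq_norm]
    linarith [norm_sub_le (ψ i ξ) (ψ i ζ₀), hR i ξ (hsub hξ), hR i ζ₀ hζ₀]
  have hlip' : ∀ ζ ∈ ball ζ₀ d, dist (φ ζ) (φ ζ₀) ≤ 2 * R / d * dist ζ ζ₀ := fun ζ hζ =>
    le_of_tendsto ((hφ ζ (hsub hζ)).dist (hφ ζ₀ hζ₀)) (Eventually.of_forall fun i => hlip i ζ hζ)
  set δ := min d (ε / (3 * (2 * R / d + 1))) with hδ
  have hδ0 : 0 < δ := by positivity
  refine ⟨ball ζ₀ δ, mem_nhdsWithin_of_mem_nhds (ball_mem_nhds _ hδ0), ?_⟩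
  filter_upwards [Metric.tendsto_nhds.1 (hφ ζ₀ hζ₀) (ε / 3) (by positivity)] with i hi ζ hζ
  have hζd : ζ ∈ ball ζ₀ d := ball_subset_ball (min_le_left _ _) hζ
  have hsmall : 2 * R / d * dist ζ ζ₀ ≤ ε / 3 := by
    have h1 : dist ζ ζ₀ ≤ ε / (3 * (2 * R / d + 1)) := (mem_ball.1 hζ).le.trans (min_le_right _ _)
    calc 2 * R / d * dist ζ ζ₀ ≤ (2 * R / d + 1) * (ε / (3 * (2 * R / d + 1))) := by
          gcongr; linarith
      _ = ε / 3 := by field_simp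
  have h1 := hlip i ζ hζd
  have h2 := hlip' ζ hζd
  have h3 := dist_triangle4 (φ ζ) (φ ζ₀) (ψ i ζ₀) (ψ i ζ)
  rw [dist_comm (φ ζ₀), dist_comm (ψ i ζ₀) (ψ i ζ)] at h3
  linarith

/-! ### Disc automorphisms and the hyperbolic distance -/

open scoped ComplexConjugate in
/-- The involution `ζ ↦ (α - ζ) / (1 - conj α * ζ)` of the unit disc, which exchanges `0` and `α`. -/
noncomputable def discInvolution (α ζ : ℂ) : ℂ := (α - ζ) / (1 - conj α * ζ)

theorem discInvolution_zero (α : ℂ) : discInvolution α 0 = α := by simp [discInvolution]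

theorem discInvolution_self (α : ℂ) : discInvolution α α = 0 := by simp [discInvolution]

open scoped ComplexConjugate in
theorem one_sub_conj_mul_ne_zero {α ζ : ℂ} (hα : ‖α‖ < 1) (hζ : ‖ζ‖ < 1) :
    1 - conj α * ζ ≠ 0 := by
  intro h
  have h1 : ‖conj α * ζ‖ = 1 := by rw [← sub_eq_zero.1 h, norm_one]
  rw [norm_mul, Complex.norm_conj] at h1
  nlinarith [norm_nonneg α, norm_nonneg ζ]

open scoped ComplexConjugate in
theorem one_sub_norm_discInvolution_sq {α ζ : ℂ} (hα : ‖α‖ < 1) (hζ : ‖ζ‖ < 1) :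
    1 - ‖discInvolution α ζ‖ ^ 2
      = (1 - ‖α‖ ^ 2) * (1 - ‖ζ‖ ^ 2) / ‖1 - conj α * ζ‖ ^ 2 := by
  have h0 : ‖1 - conj α * ζ‖ ≠ 0 := norm_ne_zero_iff.2 (one_sub_conj_mul_ne_zero hα hζ)
  rw [discInvolution, norm_div, div_pow, eq_div_iff (pow_ne_zero 2 h0), sub_mul,
    div_mul_cancel₀ _ (pow_ne_zero 2 h0)]
  simp only [← Complex.normSq_eq_norm_sq, Complex.normSq_apply, Complex.sub_re, Complex.sub_im,
    Complex.mul_re, Complex.mul_im, Complex.conj_re, Complex.conj_im, Complex.one_re,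
    Complex.one_im]
  ring

theorem norm_discInvolution_lt_one {α ζ : ℂ} (hα : ‖α‖ < 1) (hζ : ‖ζ‖ < 1) :
    ‖discInvolution α ζ‖ < 1 := by
  have h0 := norm_pos_iff.2 (one_sub_conj_mul_ne_zero hα hζ)
  have h1 := one_sub_norm_discInvolution_sq hα hζ
  have h2 : 0 < 1 - ‖α‖ ^ 2 := by nlinarith [norm_nonneg α]
  have h3 : 0 < 1 - ‖ζ‖ ^ 2 := by nlinarith [norm_nonneg ζ]
  have h4 : 0 < 1 - ‖discInvolution α ζ‖ ^ 2 := by rw [h1]; positivity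
  nlinarith [norm_nonneg (discInvolution α ζ)]

theorem mapsTo_discInvolution {α : ℂ} (hα : ‖α‖ < 1) :
    MapsTo (discInvolution α) (ball 0 1) (ball 0 1) := fun _ hζ =>
  mem_ball_zero_iff.2 (norm_discInvolution_lt_one hα (mem_ball_zero_iff.1 hζ))

theorem differentiableOn_discInvolution {α : ℂ} (hα : ‖α‖ < 1) :
    DifferentiableOn ℂ (discInvolution α) (ball 0 1) := by
  intro ζ hζ
  have := one_sub_conj_mul_ne_zero hα (mem_ball_zero_iff.1 hζ)
  unfold discInvolution
  fun_prop (disch := assumption)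

theorem discInvolution_discInvolution {α ζ : ℂ} (hα : ‖α‖ < 1) (hζ : ‖ζ‖ < 1) :
    discInvolution α (discInvolution α ζ) = ζ := by
  have h1 := one_sub_conj_mul_ne_zero hα hζ
  have h2 := one_sub_conj_mul_ne_zero hα (norm_discInvolution_lt_one hα hζ)
  have h3 : discInvolution α ζ * (1 - (starRingEnd ℂ) α * ζ) = α - ζ := div_mul_cancel₀ _ h1
  rw [discInvolution, div_eq_iff h2]
  linear_combination -h3

/-- The triangle inequality for the hyperbolic distance, through the origin: bound the denominator
in `one_sub_norm_discInvolution_sq` by 1 + ‖α‖‖ζ‖. -/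
theorem norm_discInvolution_le {α ζ : ℂ} (hα : ‖α‖ < 1) (hζ : ‖ζ‖ < 1) :
    ‖discInvolution α ζ‖ ≤ (‖α‖ + ‖ζ‖) / (1 + ‖α‖ * ‖ζ‖) := by
  have h0 := norm_pos_iff.2 (one_sub_conj_mul_ne_zero hα hζ)
  have h1 := one_sub_norm_discInvolution_sq hα hζ
  have h2 : 0 < 1 - ‖α‖ ^ 2 := by nlinarith [norm_nonneg α]
  have h3 : 0 < 1 - ‖ζ‖ ^ 2 := by nlinarith [norm_nonneg ζ]
  have h4 : ‖1 - (starRingEnd ℂ) α * ζ‖ ≤ 1 + ‖α‖ * ‖ζ‖ := by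
    refine (norm_sub_le _ _).trans_eq ?_
    rw [norm_one, norm_mul, Complex.norm_conj]
  have h5 : (1 - ‖α‖ ^ 2) * (1 - ‖ζ‖ ^ 2) / (1 + ‖α‖ * ‖ζ‖) ^ 2
      ≤ 1 - ‖discInvolution α ζ‖ ^ 2 := by
    rw [h1]; gcongr
  refine (pow_le_pow_iff_left₀ (norm_nonneg _) (by positivity) two_ne_zero).1 ?_
  have h6 : (1 - ‖α‖ ^ 2) * (1 - ‖ζ‖ ^ 2) / (1 + ‖α‖ * ‖ζ‖) ^ 2
      = 1 - ((‖α‖ + ‖ζ‖) / (1 + ‖α‖ * ‖ζ‖)) ^ 2 := by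
    field_simp
    ring
  linarith

theorem Real.artanh_add_div {s t : ℝ} (hs : s ∈ Ioo (-1) 1) (ht : t ∈ Ioo (-1) 1) :
    Real.artanh ((s + t) / (1 + s * t)) = Real.artanh s + Real.artanh t := by
  rw [← Real.artanh_tanh (Real.artanh s + Real.artanh t)]
  congr 1
  have h1 : 1 - s ^ 2 > 0 := by nlinarith [hs.1, hs.2]
  have h2 : 1 - t ^ 2 > 0 := by nlinarith [ht.1, ht.2]
  rw [Real.tanh_eq_sinh_div_cosh, Real.sinh_add, Real.cosh_add, Real.sinh_artanh hs,
    Real.sinh_artanh ht, Real.cosh_artanh hs, Real.cosh_artanh ht]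
  have h3 := Real.sqrt_pos.2 h1
  have h4 := Real.sqrt_pos.2 h2
  have h5 : 1 + s * t ≠ 0 := by nlinarith [hs.1, hs.2, ht.1, ht.2]
  field_simp

/-- A consequence of the Schwarz–Pick lemma: holomorphic self-maps of the disc do not increase the
hyperbolic distance. -/
theorem artanh_norm_le_of_mapsTo_ball {f : ℂ → ℂ} (hf : DifferentiableOn ℂ f (ball 0 1))
    (hmaps : MapsTo f (ball 0 1) (ball 0 1)) {α : ℂ} (hα : α ∈ ball (0 : ℂ) 1) :
    Real.artanh ‖f α‖ ≤ Real.artanh ‖f 0‖ + Real.artanh ‖α‖ := by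
  have h0 : ‖f 0‖ < 1 := mem_ball_zero_iff.1 (hmaps (mem_ball_self zero_lt_one))
  have hα1 : ‖α‖ < 1 := mem_ball_zero_iff.1 hα
  have hfα : ‖f α‖ < 1 := mem_ball_zero_iff.1 (hmaps hα)
  set w := discInvolution (f 0) (f α) with hw
  have hw1 : ‖w‖ < 1 := norm_discInvolution_lt_one h0 hfα
  have hwα : ‖w‖ ≤ ‖α‖ := by
    refine Complex.norm_le_norm_of_mapsTo_ball (f := fun ζ => discInvolution (f 0) (f ζ))
      ((differentiableOn_discInvolution h0).comp hf hmaps)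
      (fun ζ hζ => ball_subset_closedBall (mapsTo_discInvolution h0 (hmaps hζ)))
      (discInvolution_self _) hα1
  have hmem : ∀ {x : ℂ}, ‖x‖ < 1 → ‖x‖ ∈ Ioo (-1 : ℝ) 1 := fun {x} hx =>
    ⟨by linarith [norm_nonneg x], hx⟩
  have hlt : (‖f 0‖ + ‖w‖) / (1 + ‖f 0‖ * ‖w‖) < 1 := by
    rw [div_lt_one (by positivity)]
    nlinarith
  calc Real.artanh ‖f α‖ = Real.artanh ‖discInvolution (f 0) w‖ := by
        rw [hw, discInvolution_discInvolution h0 hfα]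
    _ ≤ Real.artanh ((‖f 0‖ + ‖w‖) / (1 + ‖f 0‖ * ‖w‖)) :=
        Real.artanh_le_artanh (by linarith [norm_nonneg (discInvolution (f 0) w)]) hlt
          (norm_discInvolution_le h0 hw1)
    _ = Real.artanh ‖f 0‖ + Real.artanh ‖w‖ := Real.artanh_add_div (hmem h0) (hmem hw1)
    _ ≤ _ := by
        gcongr
        exact Real.artanh_le_artanh (by linarith [norm_nonneg w]) hα1 hwα

/-! ### Lower bounds from linear functionals -/

/-- The Lempert function dominates the pull-back of the hyperbolic distance under a linear
functional that maps the domain into the unit disc. -/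
theorem ofReal_artanh_norm_le_add_lempert {n : ℕ} {D : Set (EuclideanSpace ℂ (Fin n))}
    (L : EuclideanSpace ℂ (Fin n) →L[ℂ] ℂ) (hL : ∀ y ∈ D, ‖L y‖ < 1)
    (z w : EuclideanSpace ℂ (Fin n)) :
    ENNReal.ofReal (Real.artanh ‖L w‖) ≤ ENNReal.ofReal (Real.artanh ‖L z‖) + lempert D z w := by
  rw [← tsub_le_iff_left]
  refine le_sInf ?_
  rintro _ ⟨φ, α, hφ, hα, rfl, rfl, rfl⟩
  rw [tsub_le_iff_left, ← ENNReal.ofReal_add (Real.artanh_nonneg (norm_nonneg _))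
    (Real.artanh_nonneg (norm_nonneg _))]
  refine ENNReal.ofReal_le_ofReal ?_
  exact artanh_norm_le_of_mapsTo_ball (f := fun ζ => L (φ ζ))
    (L.differentiable.comp_differentiableOn hφ.1)
    (fun ζ hζ => mem_ball_zero_iff.2 (hL _ (hφ.2 hζ))) hα

/-- Telescoping without subtraction, so that it applies in `ℝ≥0∞`. -/
theorem Fin.le_add_sum_of_forall_succ_le {M : Type*} [AddCommMonoid M] [PartialOrder M]
    [IsOrderedAddMonoid M] {m : ℕ} (d : Fin (m + 1) → M) (e : Fin m → M)
    (h : ∀ j, d j.succ ≤ d j.castSucc + e j) : d (Fin.last m) ≤ d 0 + ∑ j, e j := by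
  induction m with
  | zero => simp
  | succ k ih =>
    rw [Fin.sum_univ_castSucc, ← add_assoc]
    refine (h (Fin.last k)).trans ?_
    gcongr
    exact ih (fun j => d j.castSucc) (fun j => e j.castSucc) fun j => h j.castSucc

theorem ofReal_artanh_norm_le_lempertChain {n : ℕ} {D : Set (EuclideanSpace ℂ (Fin n))}
    (L : EuclideanSpace ℂ (Fin n) →L[ℂ] ℂ) (hL : ∀ y ∈ D, ‖L y‖ < 1) (m : ℕ)
    (w : EuclideanSpace ℂ (Fin n)) :
    ENNReal.ofReal (Real.artanh ‖L w‖) ≤ lempertChain D m 0 w := by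
  refine le_sInf ?_
  rintro _ ⟨p, -, hp0, rfl, rfl⟩
  have := Fin.le_add_sum_of_forall_succ_le (fun j => ENNReal.ofReal (Real.artanh ‖L (p j)‖))
    (fun j : Fin m => lempert D (p j.castSucc) (p j.succ))
    fun j => ofReal_artanh_norm_le_add_lempert L hL _ _
  simpa [hp0] using this

/-- Hahn–Banach theorem for the Minkowski function of a balanced convex open set. -/
theorem exists_clm_norm_lt_one_and_gauge_le {E : Type*} [NormedAddCommGroup E] [NormedSpace ℂ E]
    {s : Set E} (hs : Convex ℝ s) (hso : IsOpen s) (hbal : Balanced ℂ s) (h0 : (0 : E) ∈ s) (x : E) :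
    ∃ L : E →L[ℂ] ℂ, (∀ y ∈ s, ‖L y‖ < 1) ∧ gauge s x ≤ ‖L x‖ := by
  rcases (gauge_nonneg (s := s) x).eq_or_lt' with hx | hx
  · exact ⟨0, by simp, by simp [hx]⟩
  have hnot : (gauge s x)⁻¹ • x ∉ s := by
    intro hmem
    have := gauge_lt_one_of_mem_of_isOpen hso hmem
    rw [gauge_smul_of_nonneg (by positivity), smul_eq_mul, inv_mul_cancel₀ hx.ne'] at this
    exact lt_irrefl _ this
  obtain ⟨L, hL1, hL⟩ := RCLike.separate_convex_open_set (𝕜 := ℂ) h0 hs hso hnot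
  refine ⟨L, fun y hy => ?_, ?_⟩
  · obtain ⟨c, hc, hcy⟩ : ∃ c : ℂ, ‖c‖ = 1 ∧ (‖L y‖ : ℂ) = c * L y :=
      RCLike.exists_norm_eq_mul_self (L y)
    have := hL (c • y) (hbal.smul_mem hc.le hy)
    rw [map_smul, smul_eq_mul, ← hcy] at this
    simpa using this
  · have h1 : (gauge s x)⁻¹ • x = ((gauge s x)⁻¹ : ℂ) • x := by
      rw [← Complex.ofReal_inv, Complex.coe_smul]
    rw [h1, map_smul, smul_eq_mul, ← Complex.ofReal_inv] at hL1
    have h2 : (gauge s x)⁻¹ * (L x).re = 1 := by simpa using hL1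
    have h3 : (L x).re = gauge s x := by field_simp at h2; exact h2
    rw [← h3]
    exact Complex.re_le_norm _

/-- The points all of whose multiples by scalars of modulus at most 1 lie in the hull form a convex
set containing `s`. -/
theorem Balanced.convexHull_real {E : Type*} [AddCommGroup E] [Module ℂ E] {s : Set E}
    (hs : Balanced ℂ s) : Balanced ℂ (convexHull ℝ s) := by
  suffices Convex ℝ {x | ∀ a : ℂ, ‖a‖ ≤ 1 → a • x ∈ convexHull ℝ s} by
    rw [balanced_iff_smul_mem] at hs ⊢
    refine fun a ha x hx => convexHull_min ?_ this hx a ha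
    exact fun y hy a ha => subset_convexHull ℝ s (hs ha hy)
  intro x hx y hy u v hu hv huv a ha
  rw [smul_add, smul_comm a u, smul_comm a v]
  exact convex_convexHull ℝ s (hx a ha) (hy a ha) hu hv huv

/-! ### Upper bounds from explicit discs and chains -/

theorem lempert_self {n : ℕ} {D : Set (EuclideanSpace ℂ (Fin n))} {z : EuclideanSpace ℂ (Fin n)}
    (hz : z ∈ D) : lempert D z z = 0 := by
  refine le_antisymm (sInf_le ?_) zero_le
  exact ⟨fun _ => z, 0, ⟨differentiableOn_const z, fun _ _ => hz⟩, mem_ball_self zero_lt_one, rfl,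
    rfl, by simp⟩

theorem Balanced.mem_of_gauge_lt_one {E : Type*} [NormedAddCommGroup E] [NormedSpace ℂ E]
    {s : Set E} (hbal : Balanced ℂ s) (hs : Absorbent ℝ s) {x : E} (hx : gauge s x < 1) : x ∈ s := by
  obtain ⟨t, ht0, ht1, y, hy, rfl⟩ := exists_lt_of_gauge_lt hs hx
  have := hbal.smul_mem (a := (t : ℂ)) (by
    rw [Complex.norm_real, Real.norm_of_nonneg ht0.le]; exact ht1.le) hy
  simpa using this

theorem lempert_zero_smul_le {n : ℕ} {D : Set (EuclideanSpace ℂ (Fin n))} (hbal : Balanced ℂ D)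
    (hD : D ∈ 𝓝 0) (hb : Bornology.IsBounded D) (a : EuclideanSpace ℂ (Fin n)) {c : ℂ}
    (hc : ‖c‖ * gauge D a < 1) :
    lempert D 0 (c • a) ≤ ENNReal.ofReal (Real.artanh (‖c‖ * gauge D a)) := by
  have habs : Absorbent ℝ D := absorbent_nhds_zero hD
  have hg0 : gauge D a = 0 ↔ a = 0 :=
    gauge_eq_zero habs ((NormedSpace.isVonNBounded_iff ℝ).2 hb)
  -- For `a = 0` the inverse defaults to 0 and this is the constant disc; for `a ≠ 0` boundedness
  -- makes the gauge nonzero.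
  refine sInf_le ⟨fun ζ => ζ • (gauge D a)⁻¹ • a, c * gauge D a, ⟨by fun_prop, ?_⟩, ?_, by simp,
    ?_, ?_⟩
  · intro ζ hζ
    refine hbal.mem_of_gauge_lt_one habs ?_
    rw [gauge_smul hbal, gauge_smul_of_nonneg (inv_nonneg.2 (gauge_nonneg a)), smul_eq_mul]
    have h1 : (gauge D a)⁻¹ * gauge D a ≤ 1 := inv_mul_le_one
    have h2 := mem_ball_zero_iff.1 hζ
    nlinarith [norm_nonneg ζ]
  · rw [mem_ball_zero_iff, norm_mul, Complex.norm_real, Real.norm_of_nonneg (gauge_nonneg a)]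
    exact hc
  · rcases eq_or_ne a 0 with rfl | ha
    · simp
    · have h : (gauge D a : ℝ) ≠ 0 := mt hg0.1 ha
      show (c * (gauge D a : ℂ)) • (gauge D a)⁻¹ • a = c • a
      rw [mul_smul, Complex.coe_smul, smul_smul, mul_inv_cancel₀ h, one_smul]
  · rw [norm_mul, Complex.norm_real, Real.norm_of_nonneg (gauge_nonneg a)]

theorem lempertChain_le_lempert {n : ℕ} {D : Set (EuclideanSpace ℂ (Fin n))}
    {z w : EuclideanSpace ℂ (Fin n)} (hz : z ∈ D) (hw : w ∈ D) {m : ℕ} (hm : 1 ≤ m) :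
    lempertChain D m z w ≤ lempert D z w := by
  obtain ⟨k, rfl⟩ := Nat.exists_eq_add_of_le' hm
  -- The chain jumps to `w` in its first link and then stays there at no cost.
  refine sInf_le ⟨Fin.cons z fun _ => w, Fin.cases hz fun _ => hw, rfl, ?_, ?_⟩
  · rw [← Fin.succ_last, Fin.cons_succ]
  · rw [Fin.sum_univ_succ]
    have : ∀ j : Fin k, lempert D ((Fin.cons z fun _ => w : Fin (k + 2) → _) j.succ.castSucc)
        ((Fin.cons z fun _ => w : Fin (k + 2) → _) j.succ.succ) = 0 := fun j => by
      rw [← Fin.succ_castSucc, Fin.cons_succ, Fin.cons_succ, lempert_self hw]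
    rw [Finset.sum_eq_zero fun j _ => this j, add_zero]
    rfl

/-! ### Convergence passes along links of bounded length -/

/-- If points `y j` tend to a point `b` of Minkowski norm `1` at which the Minkowski function is
continuous and through which `frontier D` contains no nontrivial disc, then so do points at bounded
Lempert distance from them. -/
theorem tendsto_of_lempert_lt {n : ℕ} {D : Set (EuclideanSpace ℂ (Fin n))} (hD : IsOpen D)
    (hb : Bornology.IsBounded D) (hp : IsPseudoconvex D) (hbal : Balanced ℂ D)
    {b : EuclideanSpace ℂ (Fin n)} (hcont : ContinuousAt (gauge D) b) (hone : gauge D b = 1)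
    (hdisc : ¬ HasNontrivialDiscThrough (frontier D) b) {ι : Type*} (U : Ultrafilter ι)
    {x y : ι → EuclideanSpace ℂ (Fin n)} {C : ℝ≥0∞} (hC : C ≠ ∞)
    (hxy : ∀ i, lempert D (x i) (y i) < C) (hy : Tendsto y U (𝓝 b)) : Tendsto x U (𝓝 b) := by
  have hex : ∀ i, ∃ (φ : ℂ → EuclideanSpace ℂ (Fin n)) (α : ℂ), IsAnalyticDiscIn φ D ∧
      α ∈ ball (0 : ℂ) 1 ∧ φ 0 = x i ∧ φ α = y i ∧ ENNReal.ofReal (Real.artanh ‖α‖) < C := by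
    intro i
    obtain ⟨_, ⟨φ, α, h1, h2, h3, h4, rfl⟩, h5⟩ := sInf_lt_iff.1 (hxy i)
    exact ⟨φ, α, h1, h2, h3, h4, h5⟩
  choose f α hf hα hf0 hfα hαC using hex
  set ρ := Real.tanh C.toReal with hρ
  have hρ1 : ρ < 1 := Real.tanh_lt_one _
  have hαρ : ∀ i, ‖α i‖ ≤ ρ := by
    intro i
    have h1 : Real.artanh ‖α i‖ ≤ C.toReal :=
      ((ENNReal.ofReal_lt_iff_lt_toReal (Real.artanh_nonneg (norm_nonneg _)) hC).1 (hαC i)).le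
    rw [← Real.artanh_tanh C.toReal] at h1
    exact (Real.artanh_le_artanh_iff
      ⟨by linarith [norm_nonneg (α i)], mem_ball_zero_iff.1 (hα i)⟩
      ⟨Real.neg_one_lt_tanh _, hρ1⟩).1 h1
  have hα1 : ∀ i, ‖α i‖ < 1 := fun i => mem_ball_zero_iff.1 (hα i)
  -- Recentring puts `y i` at the origin, so the limit disc is centred at `b`; `x i` sits at `α i`,
  -- in the fixed compact disc of radius `ρ`, where convergence is uniform.
  set ψ : ι → ℂ → EuclideanSpace ℂ (Fin n) := fun i ζ => f i (discInvolution (α i) ζ) with hψ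
  have hψd : ∀ i, IsAnalyticDiscIn (ψ i) D := fun i =>
    ⟨(hf i).1.comp (differentiableOn_discInvolution (hα1 i)) (mapsTo_discInvolution (hα1 i)),
      (hf i).2.comp (mapsTo_discInvolution (hα1 i))⟩
  have hψ0 : ∀ i, ψ i 0 = y i := fun i => by simp only [hψ, discInvolution_zero, hfα]
  have hψα : ∀ i, ψ i (α i) = x i := fun i => by simp only [hψ, discInvolution_self, hf0]
  obtain ⟨R, hR⟩ := hb.exists_norm_le
  obtain ⟨φ, hφ⟩ := exists_tendstoLocallyUniformlyOn_of_bounded U (fun i => (hψd i).1)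
    fun i ζ hζ => hR _ ((hψd i).2 hζ)
  have hφ0 : φ 0 = b := by
    refine tendsto_nhds_unique (hφ.tendsto_at (mem_ball_self zero_lt_one)) ?_
    simpa only [hψ0] using hy
  have hφfr : MapsTo φ (ball 0 1) (frontier D) := by
    intro ζ hζ
    rw [hD.frontier_eq]
    refine ⟨mem_closure_of_tendsto (hφ.tendsto_at hζ) (Eventually.of_forall fun i => (hψd i).2 hζ),
      ?_⟩
    exact hp.notMem_of_tendstoLocallyUniformlyOn hD hbal hψd hφ (by rwa [hφ0]) (by rwa [hφ0]) hζ
  have hφb : ∀ ζ ∈ ball (0 : ℂ) 1, φ ζ = b := by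
    by_contra! hne
    exact hdisc ⟨φ, ⟨hφ.differentiableOn (Eventually.of_forall fun i => (hψd i).1) isOpen_ball,
      hφfr⟩, ⟨0, mem_ball_self zero_lt_one, hφ0⟩, hne⟩
  have hsub : closedBall (0 : ℂ) ρ ⊆ ball 0 1 := closedBall_subset_ball hρ1
  have hunif := (tendstoLocallyUniformlyOn_iff_forall_isCompact isOpen_ball).1 hφ _ hsub
    (isCompact_closedBall 0 ρ)
  rw [Metric.tendsto_nhds]
  intro ε hε
  filter_upwards [Metric.tendstoUniformlyOn_iff.1 hunif ε hε] with i hi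
  have hmem : α i ∈ closedBall (0 : ℂ) ρ := mem_closedBall_zero_iff.2 (hαρ i)
  have := hi _ hmem
  rwa [hφb _ (hsub hmem), hψα, dist_comm] at this

/-! ### The two implications -/

theorem tanhENN_ofReal {x : ℝ} (hx : 0 ≤ x) : tanhENN (ENNReal.ofReal x) = Real.tanh x := by
  rw [tanhENN, if_neg ENNReal.ofReal_ne_top, ENNReal.toReal_ofReal hx]

theorem le_ofReal_artanh_of_tanhENN_le {x : ℝ≥0∞} {q : ℝ} (hq : q < 1) (hx : tanhENN x ≤ q) :
    x ≤ ENNReal.ofReal (Real.artanh q) := by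
  by_cases hx' : x = ∞
  · rw [tanhENN, if_pos hx'] at hx
    linarith
  · rw [tanhENN, if_neg hx'] at hx
    rw [← ENNReal.ofReal_toReal hx', ← Real.artanh_tanh x.toReal]
    exact ENNReal.ofReal_le_ofReal (Real.artanh_le_artanh (Real.neg_one_lt_tanh _) hq hx)

theorem tanhENN_lempertChain_zero_smul {n : ℕ} {D : Set (EuclideanSpace ℂ (Fin n))}
    (hD : IsOpen D) (h0 : (0 : EuclideanSpace ℂ (Fin n)) ∈ D) (hb : Bornology.IsBounded D)
    (hbal : Balanced ℂ D) {a : EuclideanSpace ℂ (Fin n)} {m : ℕ} (hm : 1 ≤ m)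
    (ha : gauge D a = gauge (convexHull ℝ D) a) {c : ℂ} (hc : ‖c‖ * gauge D a < 1) :
    tanhENN (lempertChain D m 0 (c • a)) = gauge (convexHull ℝ D) (c • a) := by
  have hbal' : Balanced ℂ (convexHull ℝ D) := hbal.convexHull_real
  have hDn : D ∈ 𝓝 0 := hD.mem_nhds h0
  have hg0 : 0 ≤ ‖c‖ * gauge D a := mul_nonneg (norm_nonneg _) (gauge_nonneg a)
  have hmem : c • a ∈ D :=
    hbal.mem_of_gauge_lt_one (absorbent_nhds_zero hDn) (by rwa [gauge_smul hbal])
  obtain ⟨L, hL, hLa⟩ := exists_clm_norm_lt_one_and_gauge_le (convex_convexHull ℝ D)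
    hD.convexHull hbal' (subset_convexHull ℝ D h0) (c • a)
  rw [gauge_smul hbal', ← ha] at hLa ⊢
  have hLD : ∀ y ∈ D, ‖L y‖ < 1 := fun y hy => hL y (subset_convexHull ℝ D hy)
  have heq : lempertChain D m 0 (c • a) = ENNReal.ofReal (Real.artanh (‖c‖ * gauge D a)) := by
    refine le_antisymm ((lempertChain_le_lempert h0 hmem hm).trans
      (lempert_zero_smul_le hbal hDn hb a hc)) ?_
    refine le_trans (ENNReal.ofReal_le_ofReal ?_) (ofReal_artanh_norm_le_lempertChain L hLD m _)
    exact Real.artanh_le_artanh (by linarith) (hLD _ hmem) hLa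
  rw [heq, tanhENN_ofReal (Real.artanh_nonneg hg0), Real.tanh_artanh ⟨by linarith, hc⟩]

theorem gauge_eq_gauge_convexHull_of_forall_discSlice {n : ℕ}
    {D : Set (EuclideanSpace ℂ (Fin n))} (hD : IsOpen D) (hb : Bornology.IsBounded D)
    (hp : IsPseudoconvex D) (hbal : Balanced ℂ D) (h0 : (0 : EuclideanSpace ℂ (Fin n)) ∈ D)
    {a : EuclideanSpace ℂ (Fin n)} {m : ℕ} (hcont : ContinuousAt (gauge D) a)
    (hdisc : ¬ HasNontrivialDiscThrough (frontier D) ((gauge D a)⁻¹ • a))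
    (h : ∀ a' ∈ discSlice D a, tanhENN (lempertChain D m 0 a') = gauge (convexHull ℝ D) a') :
    gauge D a = gauge (convexHull ℝ D) a := by
  by_contra hne
  have hDn : D ∈ 𝓝 0 := hD.mem_nhds h0
  have hlt : gauge (convexHull ℝ D) a < gauge D a :=
    lt_of_le_of_ne (gauge_mono (absorbent_nhds_zero hDn) (subset_convexHull ℝ D) a) (Ne.symm hne)
  have hg : 0 < gauge D a := (gauge_nonneg a).trans_lt hlt
  set b := (gauge D a)⁻¹ • a with hbdef
  have hab : gauge D a • b = a := by rw [hbdef, smul_smul, mul_inv_cancel₀ hg.ne', one_smul]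
  have hone : gauge D b = 1 := by
    rw [hbdef, gauge_smul_of_nonneg (inv_nonneg.2 hg.le), smul_eq_mul, inv_mul_cancel₀ hg.ne']
  have hcb : ContinuousAt (gauge D) b := by
    have h1 : gauge D = fun x => (gauge D a)⁻¹ * gauge D (gauge D a • x) := by
      funext x
      rw [gauge_smul_of_nonneg hg.le, smul_eq_mul, inv_mul_cancel_left₀ hg.ne']
    rw [h1]
    refine continuousAt_const.mul (ContinuousAt.comp (g := gauge D)
      (f := fun x => gauge D a • x) (by rwa [hab]) (by fun_prop))
  set q := gauge (convexHull ℝ D) b with hq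
  have hq1 : q < 1 := by
    rw [hq, hbdef, gauge_smul_of_nonneg (inv_nonneg.2 hg.le), smul_eq_mul, inv_mul_lt_iff₀ hg,
      mul_one]
    exact hlt
  set t : ℕ → ℝ := fun j => 1 - 1 / ((j : ℝ) + 1) with ht
  have ht0 : ∀ j, 0 ≤ t j := fun j => by
    have : 1 / ((j : ℝ) + 1) ≤ 1 := by
      rw [div_le_one (by positivity)]; linarith [Nat.cast_nonneg (α := ℝ) j]
    simp only [ht]; linarith
  have ht1 : ∀ j, t j < 1 := fun j => by
    have : 0 < 1 / ((j : ℝ) + 1) := by positivity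
    simp only [ht]; linarith
  have htt : Tendsto (fun j => t j • b) atTop (𝓝 b) := by
    have : Tendsto t atTop (𝓝 1) := by
      simpa [ht] using tendsto_one_div_add_atTop_nhds_zero_nat (𝕜 := ℝ).const_sub 1
    simpa using this.smul_const b
  -- The extra 1 gives strict inequality, so an actual chain shorter than `C` exists for every `j`;
  -- each of its links is then shorter than `C` too.
  set C := ENNReal.ofReal (Real.artanh q) + 1 with hC
  have hCtop : C ≠ ∞ := by simp [hC]
  have hchain : ∀ j, ∃ p : Fin (m + 1) → EuclideanSpace ℂ (Fin n), p 0 = 0 ∧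
      p (Fin.last m) = t j • b ∧ ∀ i : Fin m, lempert D (p i.castSucc) (p i.succ) < C := by
    intro j
    have hmem : t j • b ∈ discSlice D a := by
      refine ⟨((t j * (gauge D a)⁻¹ : ℝ) : ℂ), ?_, ?_⟩
      · rw [Complex.norm_real, Real.norm_of_nonneg (mul_nonneg (ht0 j) (inv_nonneg.2 hg.le)),
          mul_assoc, inv_mul_cancel₀ hg.ne', mul_one]
        exact ht1 j
      · rw [Complex.coe_smul, mul_smul]
    have hle : lempertChain D m 0 (t j • b) ≤ ENNReal.ofReal (Real.artanh q) := by
      refine le_ofReal_artanh_of_tanhENN_le hq1 ?_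
      rw [h _ hmem, gauge_smul_of_nonneg (ht0 j), smul_eq_mul]
      exact mul_le_of_le_one_left (gauge_nonneg b) (ht1 j).le
    have hlt' : lempertChain D m 0 (t j • b) < C :=
      hle.trans_lt (ENNReal.lt_add_right ENNReal.ofReal_ne_top one_ne_zero)
    obtain ⟨_, ⟨p, -, hp0, hpl, rfl⟩, hsum⟩ := sInf_lt_iff.1 hlt'
    exact ⟨p, hp0, hpl, fun i => (Finset.single_le_sum_of_canonicallyOrdered
      (f := fun i : Fin m => lempert D (p i.castSucc) (p i.succ)) (Finset.mem_univ i)).trans_lt hsum⟩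
  choose p hp0 hpl hpC using hchain
  -- One ultrafilter serves all links, in place of successive subsequences.
  set U : Ultrafilter ℕ := Ultrafilter.of atTop with hU
  have hlim : ∀ i : Fin (m + 1), Tendsto (fun j => p j i) U (𝓝 b) := by
    intro i
    -- The known limit is at the end of the chain, so convergence is propagated backwards to `p j 0
    -- = 0`.
    induction i using Fin.reverseInduction with
    | last =>
      simp only [hpl]
      exact htt.mono_left (Ultrafilter.of_le _)
    | cast i ih =>
      exact tendsto_of_lempert_lt hD hb hp hbal hcb hone hdisc U hCtop (fun j => hpC j i) ih
  have hb0 : b = 0 := by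
    have := hlim 0
    simp only [hp0] at this
    exact tendsto_nhds_unique this tendsto_const_nhds
  rw [hb0, gauge_zero] at hone
  exact zero_ne_one hone

theorem proposition7 {n : ℕ} (D : Set (EuclideanSpace ℂ (Fin n)))
    (hD_open : IsOpen D) (hD_conn : IsConnected D)
    (hD_bdd : Bornology.IsBounded D) (hD_psc : IsPseudoconvex D) (hD_bal : Balanced ℂ D)
    (a : EuclideanSpace ℂ (Fin n)) (ha : a ∈ D) (m : ℕ) (hm : 1 ≤ m)
    (hcont : ContinuousAt (gauge D) a)
    (hdisc : ¬ HasNontrivialDiscThrough (frontier D) ((gauge D a)⁻¹ • a)) :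
    (∀ a' ∈ discSlice D a, tanhENN (lempertChain D m 0 a') = gauge (convexHull ℝ D) a') ↔
      gauge D a = gauge (convexHull ℝ D) a := by
  have h0 : (0 : EuclideanSpace ℂ (Fin n)) ∈ D := by
    simpa using hD_bal.smul_mem (a := (0 : ℂ)) (by simp) ha
  refine ⟨gauge_eq_gauge_convexHull_of_forall_discSlice hD_open hD_bdd hD_psc hD_bal h0 hcont hdisc,
    ?_⟩
  rintro h _ ⟨c, hc, rfl⟩
  exact tanhENN_lempertChain_zero_smul hD_open h0 hD_bdd hD_bal hm h hc
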